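/- **Theorem (data privacy of the online mechanism).** Let $\mathcal X$ be a finite data universe, let $n,k\ge 1$ be integers, and let $\varepsilon,\delta,\beta\in(0,1]$. A linear query is a function $q:\mathcal X\to[0,1]$; write $q(D)=\frac1n\sum_{i=1}^n q(x^{(i)})$ for a database $D=(x^{(1)},\dots,x^{(n)})\in\mathcal X^n$ and $q(p)=\sum_{x}p(x)q(x)$ for a distribution $p$ on $\mathcal X$. $\mathrm{Lap}(b)$ is the distribution on $\mathbb R$ with density $\frac1{2b}e^{-|x|/b}$. Logarithms are natural. Set $$s=\frac{128\,n^{2/5}\sqrt{\log|\mathcal X|\,\log(4k/\beta)\,\log(1/\delta)}}{\varepsilon},\quad \hat n=\lceil 32\,n^{4/5}\log(4k/\beta)\rceil,\quad T=n^{4/5}\log|\mathcal X|,\quad R=2sT,$$ $$\sigma=\frac{20000\,\log^{3/4}|\mathcal X|\,\log^{1/4}(4k/\beta)\,\log^{5/4}(4/\delta)}{\varepsilon^{3/2}n^{2/5}},\qquad \tau=\frac{80000\,\log^{3/4}|\mathcal X|\,\log^{5/4}(4k/\beta)\,\log^{5/4}(4/\delta)}{\varepsilon^{3/2}n^{2/5}},$$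 and let $\alpha'\in\mathbb R$ be any step size. On input a database $D\in\mathcal X^n$ and a fixed (non-adaptive) sequence $q_1,\dots,q_k$ of linear queries, the online mechanism runs as follows, all random draws being independent. *Initialize:* $D_0=H_0$ is the uniform distribution on $\mathcal X$, $\mathcal U_0=\emptyset$, $s_0=s+\mathrm{Lap}(2/\varepsilon)$, $t=0$, $r=0$. *For $i=1,\dots,k$, as long as $t<T$ and $r<R$* (the mechanism halts as soon as this fails): draw $z_i\sim\mathrm{Lap}(\sigma)$. If $|q_i(D)-q_i(H_t)+z_i|\le\tau$, output $q_i(H_t)$. Otherwise let $u=\mathrm{sgn}(q_i(H_t)-q_i(D)-z_i)\cdot q_i$, add $u$ to the set $\mathcal U_t$, output $q_i(D)+z_i$, and increase $r$ by $1$; if now $|\mathcal U_t|>s_t$, then let $$D_{t+1}(x)\propto\exp\Bigl(-\frac{\alpha'}{2}\cdot\frac1{3s}\sum_{u\in\mathcal U_t}u(x)\Bigr)D_t(x)$$ be normalized to a probability distribution, let $H_{t+1}$ be the empirical distribution of $\hat n$ independent samples from $D_{t+1}$, let $\mathcal U_{t+1}=\emptyset$ and $s_{t+1}=s+\mathrm{Lap}(2/\varepsilon)$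 (a fresh draw), and increase $t$ by $1$. Then, for every fixed sequence $q_1,\dots,q_k$ of linear queries, the map from $D$ to the (finite) sequence of answers output by this mechanism is $(\varepsilon,\delta)$-differentially private with respect to the database: its output on every database is a well-defined random variable, and for any two databases $D,D'\in\mathcal X^n$ that differ in at most one row and every measurable set $S$ of finite sequences of real numbers, the output $\mathcal A(D)$ satisfies $$\Pr[\mathcal A(D)\in S]\le e^{\varepsilon}\,\Pr[\mathcal A(D')\in S]+\delta .$$ -/

import Mathlib

open MeasureTheory

namespace OnlineQueryRelease

/-- Two databases with `n` rows are adjacent if they differ on at most a single row. -/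
def Adjacent {X : Type*} {n : ℕ} (D D' : Fin n → X) : Prop :=
  ∃ i, ∀ j, j ≠ i → D j = D' j

/-- `(ε, δ)`-differential privacy of a randomized mechanism, given by the law `A D` of its output
on each database `D`. That `A D` really is a probability law is part of the definition. -/
def IsDifferentiallyPrivate {X R : Type*} [MeasurableSpace R] {n : ℕ} (ε δ : ℝ)
    (A : (Fin n → X) → Measure R) : Prop :=
  (∀ D, IsProbabilityMeasure (A D)) ∧
    ∀ D D', Adjacent D D' → ∀ S, MeasurableSet S →
      A D S ≤ ENNReal.ofReal (Real.exp ε) * A D' S + ENNReal.ofReal δ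

/-- The centred Laplace distribution `Lap(b)` of scale `b > 0`. -/
noncomputable def laplace (b : ℝ) : Measure ℝ :=
  volume.withDensity fun x => ENNReal.ofReal (Real.exp (-|x| / b) / (2 * b))

/-- The value `q(D)` of the linear query `q` on the database `D`: the average over the rows. -/
noncomputable def evalDatabase {X : Type*} {n : ℕ} (q : X → ℝ) (D : Fin n → X) : ℝ :=
  (∑ i, q (D i)) / n

/-- The value of the linear query `q` on a distribution `p` over the data universe. -/
noncomputable def evalDist {X : Type*} [Fintype X] (q : X → ℝ) (p : X → ℝ) : ℝ :=
  ∑ x, p x * q x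

/-- The uniform distribution on the data universe. -/
noncomputable def uniform (X : Type*) [Fintype X] : X → ℝ := fun _ => 1 / Fintype.card X

open Classical in
/-- The empirical distribution of a sample of size `m`. -/
noncomputable def empirical {X : Type*} {m : ℕ} (h : Fin m → X) : X → ℝ :=
  fun x => ((Finset.univ.filter fun j => h j = x).card : ℝ) / m

/-- A finite sequence of real answers, of arbitrary length. -/
abbrev Answers : Type := Σ m : ℕ, (Fin m → ℝ)

/-- The empty sequence of answers. -/
def Answers.nil : Answers := ⟨0, Fin.elim0⟩

/-- Prepend an answer. -/
def Answers.cons (y : ℝ) (a : Answers) : Answers := ⟨a.1 + 1, Fin.cons y a.2⟩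

/-- The numerical parameters of the online mechanism. -/
structure Config where
  /-- the privacy parameter `ε`, which fixes the scale `2 / ε` of the noise on the batch size -/
  eps : ℝ
  /-- the nominal batch size `s` -/
  batch : ℝ
  /-- the number `n̂` of samples of which a hypothesis consists -/
  numSamples : ℕ
  /-- the bound `T` on the number of epochs -/
  maxEpochs : ℝ
  /-- the bound `R` on the number of bad rounds -/
  maxBad : ℝ
  /-- the scale `σ` of the noise on the answers -/
  noise : ℝ
  /-- the threshold `τ` that separates good rounds from bad ones -/
  threshold : ℝ
  /-- the step size `α'` of the multiplicative weights update -/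
  step : ℝ

/-- The parameters of the mechanism for databases with `n` rows, a data universe of `N` elements and
`k` queries. The sample size is rounded up to an integer. -/
noncomputable def Config.online (n N k : ℕ) (ε δ β step : ℝ) : Config where
  eps := ε
  batch := 128 * (n : ℝ) ^ (2 / 5 : ℝ) *
    √(Real.log N * Real.log (4 * k / β) * Real.log (1 / δ)) / ε
  numSamples := ⌈32 * (n : ℝ) ^ (4 / 5 : ℝ) * Real.log (4 * k / β)⌉₊
  maxEpochs := (n : ℝ) ^ (4 / 5 : ℝ) * Real.log N
  maxBad := 2 *
    (128 * (n : ℝ) ^ (2 / 5 : ℝ) *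
      √(Real.log N * Real.log (4 * k / β) * Real.log (1 / δ)) / ε) *
    ((n : ℝ) ^ (4 / 5 : ℝ) * Real.log N)
  noise := 20000 * Real.log N ^ (3 / 4 : ℝ) * Real.log (4 * k / β) ^ (1 / 4 : ℝ) *
    Real.log (4 / δ) ^ (5 / 4 : ℝ) / (ε ^ (3 / 2 : ℝ) * (n : ℝ) ^ (2 / 5 : ℝ))
  threshold := 80000 * Real.log N ^ (3 / 4 : ℝ) * Real.log (4 * k / β) ^ (5 / 4 : ℝ) *
    Real.log (4 / δ) ^ (5 / 4 : ℝ) / (ε ^ (3 / 2 : ℝ) * (n : ℝ) ^ (2 / 5 : ℝ))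
  step := step

/-- One multiplicative weights update of the distribution `p` with the set `U` of update queries,
followed by normalization. -/
noncomputable def mwUpdate {X : Type*} [Fintype X] (c : Config) (U : Finset (X → ℝ)) (p : X → ℝ) :
    X → ℝ :=
  let w : X → ℝ := fun x =>
    Real.exp (-(c.step / 2) * (1 / (3 * c.batch) * ∑ u ∈ U, u x)) * p x
  fun x => w x / ∑ y, w y

/-- The law of `F h`, where `h` consists of `m` independent samples from the distribution `p` on the
finite set `X` and `F h` is itself random (given by its law): a mixture over all samples. -/
noncomputable def withSamples {X R : Type*} [Fintype X] [MeasurableSpace R] (m : ℕ) (p : X → ℝ)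
    (F : (Fin m → X) → Measure R) : Measure R :=
  ∑ h : Fin m → X, ENNReal.ofReal (∏ j, p (h j)) • F h

open Classical in
/-- The law of the answers that the mechanism gives from some point of its execution on, on the
remaining queries. The state consists of the current distribution `p` (`D_t`), the current
hypothesis `H` (`H_t`), the set `U` of update queries collected in the current epoch (`U_t`), the
noisy batch size `s` of the current epoch (`s_t`), the number `t` of completed epochs and the number
`r` of bad rounds so far. When one of the two limits is reached, the mechanism halts and answers no
further query. -/
noncomputable def run {X : Type*} [Fintype X] {n : ℕ} (c : Config) (D : Fin n → X) :
    List (X → ℝ) → (p H : X → ℝ) → (U : Finset (X → ℝ)) → (s : ℝ) → (t r : ℕ) → Measure Answers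
  | [], _, _, _, _, _, _ => Measure.dirac Answers.nil
  | q :: qs, p, H, U, s, t, r =>
    if (t : ℝ) < c.maxEpochs ∧ (r : ℝ) < c.maxBad then
      (laplace c.noise).bind fun z =>
        if |evalDatabase q D - evalDist q H + z| ≤ c.threshold then
          (run c D qs p H U s t r).map (Answers.cons (evalDist q H))
        else
          let u : X → ℝ := fun x => Real.sign (evalDist q H - evalDatabase q D - z) * q x
          let U' : Finset (X → ℝ) := insert u U
          (if s < U'.card then
              withSamples c.numSamples (mwUpdate c U' p) fun h =>
                (laplace (2 / c.eps)).bind fun y =>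
                  run c D qs (mwUpdate c U' p) (empirical h) ∅ (c.batch + y) (t + 1) (r + 1)
            else run c D qs p H U' s t (r + 1)).map
            (Answers.cons (evalDatabase q D + z))
    else Measure.dirac Answers.nil

/-- The law of the output of the online mechanism with parameters `c` on the database `D` and the
fixed query sequence `q`. Initially the distribution and the hypothesis are uniform. -/
noncomputable def mechanism {X : Type*} [Fintype X] {n k : ℕ} (c : Config) (q : Fin k → X → ℝ)
    (D : Fin n → X) : Measure Answers :=
  (laplace (2 / c.eps)).bind fun y =>
    run c D (List.ofFn q) (uniform X) (uniform X) ∅ (c.batch + y) 0 0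

end OnlineQueryRelease

namespace OnlineQueryRelease

/-! ### Scalar estimates -/

/-! Given the history, the batch-size noise and the samples have the same law on both databases.
Only the noisy answers differ: they follow two Laplace laws whose likelihood ratio lies between `exp
(-η)` and `exp η`, where `η = 1 / (n σ)`. Charging all `k` rounds would cost too much; the point is
that only bad rounds cost anything.

In a good round the output and the next state do not depend on the noisy answer, so the good
outcomes `A` merge into one, with ratio `a = P A / Q A`. Since `P A - Q A = -(P Aᶜ - Q Aᶜ)`, the
second-order deviation of `a`, weighted by `Q A`, is controlled by `Q Aᶜ`. In the moment of order
`M` of the ratio the first-order terms cancel, and the second-order loss is proportional to the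
probability `Q Aᶜ` of a bad round. A discount `exp (-κ)` on bad outcomes, with `κ = 144 (M η)²`,
pays for it (`decay_pays`, `round_moment_le_one`).

Moments are carried in the dual form `IsDominated`, a hockey-stick bound for every multiplier `l` at
once. `round_bound` pulls it back through one round by using the bound of the continuation at `l /
x`, where `x` is the likelihood ratio. Induction on the queries (`isDominated_run`) gives the
constant `exp (κ (R + 1 - r))`. With `m` about `2 log (4/δ) / ε` this starts at `e` or below
(`online_budget`), and `l = exp ε` leaves an error of at most `δ` (`mechanism_le`). -/

lemma sq_log_le {x E : ℝ} (hE : 1 ≤ E) (hx : 0 < x) (hlo : 1 ≤ E * x) :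
    Real.log x ^ 2 ≤ E ^ 2 * (x - 1) ^ 2 := by
  have hup := Real.log_le_sub_one_of_pos hx
  have hlow := Real.one_sub_inv_le_log_of_pos hx
  have hinv : x⁻¹ ≤ E := by
    rw [inv_le_iff_one_le_mul₀ hx]; exact hlo
  rw [← mul_pow]
  apply sq_le_sq.2
  rw [abs_mul, abs_of_pos (by linarith : 0 < E)]
  rcases le_total 1 x with h | h
  · have h0 : 0 ≤ Real.log x := Real.log_nonneg h
    rw [abs_of_nonneg h0, abs_of_nonneg (by linarith)]
    nlinarith
  · have h0 : Real.log x ≤ 0 := Real.log_nonpos hx.le h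
    rw [abs_of_nonpos h0, abs_of_nonpos (by linarith)]
    have : x⁻¹ - 1 = x⁻¹ * (1 - x) := by field_simp
    nlinarith [mul_le_mul_of_nonneg_right hinv (by linarith : 0 ≤ 1 - x)]

/-- A second-order bound for the power `x ^ M` near `x = 1`. -/
lemma pow_le_second_order {x η : ℝ} {M : ℕ} (hη : 0 ≤ η) (hM : M * η ≤ 1)
    (hlo : Real.exp (-η) ≤ x) (hhi : x ≤ Real.exp η) :
    x ^ M ≤ 1 + M * (x - 1) + (M * Real.exp η) ^ 2 * (x - 1) ^ 2 := by
  have hx : 0 < x := (Real.exp_pos _).trans_le hlo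
  have h1 : -η ≤ Real.log x := by rwa [Real.le_log_iff_exp_le hx]
  have h2 : Real.log x ≤ η := by rwa [Real.log_le_iff_le_exp hx]
  have hu : |M * Real.log x| ≤ 1 := by
    rw [abs_mul, abs_of_nonneg (Nat.cast_nonneg M)]
    exact (mul_le_mul_of_nonneg_left (abs_le.2 ⟨h1, h2⟩) (Nat.cast_nonneg M)).trans hM
  have h3 := (abs_le.1 (Real.abs_exp_sub_one_sub_id_le hu)).2
  rw [Real.exp_nat_mul, Real.exp_log hx, mul_pow] at h3
  have h4 := sq_log_le (Real.one_le_exp hη) hx (by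
    calc (1 : ℝ) = Real.exp η * Real.exp (-η) := by rw [← Real.exp_add]; simp
      _ ≤ _ := by gcongr)
  have h5 := mul_le_mul_of_nonneg_left (Real.log_le_sub_one_of_pos hx) (Nat.cast_nonneg (α := ℝ) M)
  have h6 := mul_le_mul_of_nonneg_left h4 (sq_nonneg (M : ℝ))
  rw [mul_pow]
  linarith

lemma exp_sub_one_le_two_mul {η : ℝ} (hη : 0 ≤ η) (hη1 : η ≤ 1) : Real.exp η - 1 ≤ 2 * η := by
  have := (abs_le.1 (Real.abs_exp_sub_one_sub_id_le (x := η) (by rwa [abs_of_nonneg hη]))).2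
  nlinarith

lemma abs_sub_one_le {x η : ℝ}
    (hlo : Real.exp (-η) ≤ x) (hhi : x ≤ Real.exp η) : |x - 1| ≤ Real.exp η - 1 := by
  rw [abs_le]
  refine ⟨?_, by linarith⟩
  have h1 := Real.add_one_le_exp (-η)
  have h2 := Real.add_one_le_exp η
  linarith

/-- The decay `exp (-κ)` of the budget per bad round pays for the second-order loss. -/
lemma decay_pays {η κ : ℝ} {M : ℕ} (hη : 0 ≤ η) (hM : 1 ≤ M)
    (hκ : κ = 144 * (M * η) ^ 2) (hκ1 : κ ≤ 1) :
    2 * ((M * Real.exp η) ^ 2 * (Real.exp η - 1) ^ 2) ≤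
      (1 - Real.exp (-κ)) * Real.exp (-η) ^ M := by
  have hM' : (1 : ℝ) ≤ M := by exact_mod_cast hM
  have hw0 : 0 ≤ M * η := by positivity
  have hw : M * η ≤ 1 / 12 := by
    by_contra! h
    nlinarith
  have hηw : η ≤ 1 / 12 := le_trans (by nlinarith) hw
  have he2 : Real.exp η ^ 2 ≤ 3 := by
    rw [← Real.exp_nat_mul]
    calc Real.exp ((2 : ℕ) * η) ≤ Real.exp 1 := Real.exp_le_exp.2 (by push_cast; linarith)
      _ ≤ 3 := by linarith [Real.exp_one_lt_d9]
  have he1 : (Real.exp η - 1) ^ 2 ≤ (2 * η) ^ 2 := by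
    have := exp_sub_one_le_two_mul hη (by linarith)
    have h0 : 0 ≤ Real.exp η - 1 := by linarith [Real.one_le_exp hη]
    gcongr
  have hlow : 1 / 3 ≤ Real.exp (-η) ^ M := by
    rw [← Real.exp_nat_mul]
    have := Real.add_one_le_exp ((M : ℝ) * -η)
    linarith
  have hk : κ / 2 ≤ 1 - Real.exp (-κ) := by
    have hκ0 : 0 ≤ κ := by rw [hκ]; positivity
    have h1 : Real.exp (-κ) ≤ (1 + κ)⁻¹ := by
      rw [Real.exp_neg]
      apply inv_anti₀ (by linarith)
      linarith [Real.add_one_le_exp κ]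
    have h2 : (1 + κ)⁻¹ ≤ 1 - κ / 2 := by
      rw [inv_le_iff_one_le_mul₀ (by linarith)]
      nlinarith
    linarith
  have hκ0 : 0 ≤ κ := by rw [hκ]; positivity
  -- The left side is at most `24 (M η)²`, and the right side is at least `κ / 6`; equating the two
  -- is where 144 comes from.
  calc 2 * ((M * Real.exp η) ^ 2 * (Real.exp η - 1) ^ 2)
      = 2 * (M ^ 2 * (Real.exp η ^ 2 * (Real.exp η - 1) ^ 2)) := by ring
    _ ≤ 2 * (M ^ 2 * (3 * (2 * η) ^ 2)) := by gcongr
    _ = κ / 2 * (1 / 3) := by rw [hκ]; ring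
    _ ≤ _ := by
      apply mul_le_mul hk hlow (by norm_num) (by linarith)

/-! ### One round -/

section Round

variable {Ω : Type*} [MeasurableSpace Ω]

/-- The moment of the likelihood ratio of one round, when the outcomes in `A` are merged into one
and the others are discounted by `ρ`, is at most one. -/
lemma round_moment_le_one {P Q : Measure Ω} [IsProbabilityMeasure P] [IsProbabilityMeasure Q]
    {x : Ω → ℝ} (hx : Measurable x) {η κ : ℝ} {M : ℕ} (hη : 0 ≤ η) (hM : 1 ≤ M)
    (hκ : κ = 144 * (M * η) ^ 2) (hκ1 : κ ≤ 1)
    (hlo : ∀ y, Real.exp (-η) ≤ x y) (hhi : ∀ y, x y ≤ Real.exp η)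
    (hPQ : ∀ B, MeasurableSet B → P.real B = ∫ y in B, x y ∂Q)
    {A : Set Ω} (hA : MeasurableSet A) {a : ℝ}
    (halo : Real.exp (-η) ≤ a) (hahi : a ≤ Real.exp η) (ha : P.real A = a * Q.real A) :
    Q.real A * a ^ M + Real.exp (-κ) * ∫ y in Aᶜ, x y ^ M ∂Q ≤ 1 := by
  set E := Real.exp η with hE
  set C := (M * E) ^ 2 with hC
  have hC0 : 0 ≤ C := sq_nonneg _
  have hM' : (1 : ℝ) ≤ M := by exact_mod_cast hM
  have hw : M * η ≤ 1 := by
    have hw0 : 0 ≤ M * η := by positivity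
    by_contra! h
    nlinarith
  have hpay := decay_pays hη hM hκ hκ1
  rw [← hE, ← hC] at hpay
  have hq1 : Q.real A + Q.real Aᶜ = 1 := by rw [measureReal_add_measureReal_compl hA]; simp
  have hp1 : P.real A + P.real Aᶜ = 1 := by rw [measureReal_add_measureReal_compl hA]; simp
  have hxpos : ∀ y, 0 < x y := fun y => (Real.exp_pos _).trans_le (hlo y)
  have hintx : Integrable x (Q.restrict Aᶜ) := by
    refine Integrable.of_bound hx.aestronglyMeasurable E (Filter.Eventually.of_forall fun y => ?_)
    rw [Real.norm_of_nonneg (hxpos y).le]; exact hhi y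
  have hintM : Integrable (fun y => x y ^ M) (Q.restrict Aᶜ) := by
    refine Integrable.of_bound (hx.pow_const M).aestronglyMeasurable (E ^ M)
      (Filter.Eventually.of_forall fun y => ?_)
    rw [norm_pow, Real.norm_of_nonneg (hxpos y).le]
    exact pow_le_pow_left₀ (hxpos y).le (hhi y) M
  -- merged outcomes
  have hgood : Q.real A * a ^ M ≤
      Q.real A + M * (P.real A - Q.real A) + C * ((E - 1) ^ 2 * Q.real Aᶜ) := by
    have h1 := pow_le_second_order hη hw halo hahi
    rw [← hE, ← hC] at h1
    have h2 := mul_le_mul_of_nonneg_left h1 (measureReal_nonneg (μ := Q) (s := A))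
    have habs : |P.real Aᶜ - Q.real Aᶜ| ≤ (E - 1) * Q.real Aᶜ := by
      rw [hPQ _ hA.compl]
      have : ∫ y in Aᶜ, x y ∂Q - Q.real Aᶜ = ∫ y in Aᶜ, (x y - 1) ∂Q := by
        rw [integral_sub hintx (integrable_const _)]; simp
      rw [this, ← Real.norm_eq_abs]
      refine (norm_integral_le_of_norm_le_const (C := E - 1)
        (Filter.Eventually.of_forall fun y => abs_sub_one_le (hlo y) (hhi y))).trans ?_
      simp
    -- One factor `a - 1` turns `Q A` into `P A - Q A`, which is minus the difference on `Aᶜ`. Hence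
    -- the loss of the merged outcome scales with `Q Aᶜ`, not with `Q A`.
    have h3 : Q.real A * (a - 1) ^ 2 ≤ (E - 1) ^ 2 * Q.real Aᶜ := by
      calc Q.real A * (a - 1) ^ 2 = (P.real A - Q.real A) * (a - 1) := by rw [ha]; ring
        _ ≤ |P.real A - Q.real A| * |a - 1| := by rw [← abs_mul]; exact le_abs_self _
        _ = |P.real Aᶜ - Q.real Aᶜ| * |a - 1| := by
          rw [abs_sub_comm]; congr 2; linarith
        _ ≤ ((E - 1) * Q.real Aᶜ) * (E - 1) :=
          mul_le_mul habs (abs_sub_one_le halo hahi) (abs_nonneg _)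
            ((abs_nonneg _).trans habs)
        _ = _ := by ring
    have h4 := mul_le_mul_of_nonneg_left h3 hC0
    have h5 : M * (P.real A - Q.real A) = Q.real A * (M * (a - 1)) := by rw [ha]; ring
    calc Q.real A * a ^ M ≤ _ := h2
      _ = Q.real A + Q.real A * (M * (a - 1)) + C * (Q.real A * (a - 1) ^ 2) := by ring
      _ ≤ _ := by rw [h5]; linarith
  -- separate outcomes
  have hbad : Real.exp (-κ) * ∫ y in Aᶜ, x y ^ M ∂Q ≤
      Q.real Aᶜ + M * (P.real Aᶜ - Q.real Aᶜ) - C * ((E - 1) ^ 2 * Q.real Aᶜ) := by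
    -- The discount is worth `2 C (E - 1)²`: one copy cancels the second-order term here, and the
    -- other is left over to pay for the merged outcome.
    have hpt : ∀ y, Real.exp (-κ) * x y ^ M ≤
        (1 - M - C * (E - 1) ^ 2) + M * x y := by
      intro y
      have h1 := pow_le_second_order hη hw (hlo y) (hhi y)
      rw [← hE, ← hC] at h1
      have h2 : (x y - 1) ^ 2 ≤ (E - 1) ^ 2 := by
        rw [← sq_abs]
        exact pow_le_pow_left₀ (abs_nonneg _) (abs_sub_one_le (hlo y) (hhi y)) 2
      have h3 := mul_le_mul_of_nonneg_left h2 hC0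
      have hκ0 : 0 ≤ κ := by rw [hκ]; positivity
      have h4 : (1 - Real.exp (-κ)) * Real.exp (-η) ^ M ≤ (1 - Real.exp (-κ)) * x y ^ M := by
        apply mul_le_mul_of_nonneg_left
        · exact pow_le_pow_left₀ (Real.exp_pos _).le (hlo y) M
        · have := Real.exp_le_one_iff.2 (neg_nonpos.2 hκ0)
          linarith
      linarith
    rw [← integral_const_mul]
    refine (integral_mono (hintM.const_mul _)
      ((integrable_const _).add (hintx.const_mul _)) hpt).trans ?_
    simp only [Pi.add_apply]
    rw [integral_add (integrable_const _) (hintx.const_mul _), integral_const_mul,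
      ← hPQ _ hA.compl]
    simp
    nlinarith
  nlinarith

end Round


/-! ### Transporting hockey-stick bounds through one round -/

section Round

variable {Ω : Type*} [MeasurableSpace Ω]

lemma measureReal_withDensity_ofReal {Q : Measure Ω} [IsFiniteMeasure Q]
    {x : Ω → ℝ} (hx : Measurable x) (hpos : ∀ y, 0 ≤ x y)
    {B : Set Ω} (hB : MeasurableSet B) :
    (Q.withDensity fun y => ENNReal.ofReal (x y)).real B = ∫ y in B, x y ∂Q := by
  rw [measureReal_def, withDensity_apply _ hB, integral_eq_lintegral_of_nonneg_ae
    (Filter.Eventually.of_forall hpos) hx.aestronglyMeasurable]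

/-- If the likelihood ratio is bounded pointwise, so is the ratio of the probabilities of `A`. -/
lemma exists_ratio {P Q : Measure Ω} [IsProbabilityMeasure P] [IsProbabilityMeasure Q]
    {x : Ω → ℝ} (hx : Measurable x) {η : ℝ} (hη : 0 ≤ η)
    (hlo : ∀ y, Real.exp (-η) ≤ x y) (hhi : ∀ y, x y ≤ Real.exp η)
    {A : Set Ω} (hPQ : P.real A = ∫ y in A, x y ∂Q) :
    ∃ a, Real.exp (-η) ≤ a ∧ a ≤ Real.exp η ∧ P.real A = a * Q.real A := by
  have hxpos : ∀ y, 0 < x y := fun y => (Real.exp_pos _).trans_le (hlo y)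
  have hintx : Integrable x (Q.restrict A) := by
    refine Integrable.of_bound hx.aestronglyMeasurable (Real.exp η)
      (Filter.Eventually.of_forall fun y => ?_)
    rw [Real.norm_of_nonneg (hxpos y).le]; exact hhi y
  have h1 : Real.exp (-η) * Q.real A ≤ P.real A := by
    have := integral_mono (integrable_const (Real.exp (-η))) hintx hlo
    rw [hPQ]; simpa [mul_comm] using this
  have h2 : P.real A ≤ Real.exp η * Q.real A := by
    have := integral_mono hintx (integrable_const (Real.exp η)) hhi
    rw [hPQ]; simpa [mul_comm] using this
  rcases (measureReal_nonneg (μ := Q) (s := A)).eq_or_lt with h | h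
  -- If `Q A = 0` then `P A = 0`, and any ratio in the range serves.
  · refine ⟨1, Real.exp_le_one_iff.2 (by linarith), Real.one_le_exp hη, ?_⟩
    rw [← h] at h1 h2 ⊢
    linarith
  · exact ⟨P.real A / Q.real A, by rwa [le_div_iff₀ h], by rwa [div_le_iff₀ h], by field_simp⟩

/-- The tilted form of a hockey-stick bound: rescaling the multiplier by a likelihood ratio. -/
lemma ofReal_mul_le_of_forall {u v : ENNReal} {G : ℝ} {m : ℕ}
    (h : ∀ l : ℝ, 0 < l → u ≤ ENNReal.ofReal l * v + ENNReal.ofReal (G / l ^ m))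
    {a l : ℝ} (ha : 0 < a) (hl : 0 < l) :
    ENNReal.ofReal a * u ≤ ENNReal.ofReal l * v + ENNReal.ofReal (G / l ^ m * a ^ (m + 1)) := by
  -- At the multiplier `l / a` the factor `a` cancels in the main term, while the error gains `a ^
  -- (m + 1)`: hence moments of order `m + 1`.
  refine (mul_le_mul_right (h (l / a) (by positivity)) _).trans_eq ?_
  rw [mul_add, ← mul_assoc, ← ENNReal.ofReal_mul ha.le, ← ENNReal.ofReal_mul ha.le]
  have h1 : a * (l / a) = l := by field_simp
  have h2 : a * (G / (l / a) ^ m) = G / l ^ m * a ^ (m + 1) := by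
    rw [div_pow]; field_simp; ring
  rw [h1, h2]

/-- Composition of the hockey-stick bounds of the continuations with one round. -/
lemma round_bound {P Q : Measure Ω} [IsProbabilityMeasure P] [IsProbabilityMeasure Q]
    {x : Ω → ℝ} (hx : Measurable x) {η κ : ℝ} {m : ℕ} (hη : 0 ≤ η)
    (hκ : κ = 144 * ((m + 1 : ℕ) * η) ^ 2) (hκ1 : κ ≤ 1)
    (hlo : ∀ y, Real.exp (-η) ≤ x y) (hhi : ∀ y, x y ≤ Real.exp η)
    (hPQ : P = Q.withDensity fun y => ENNReal.ofReal (x y))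
    {A : Set Ω} (hA : MeasurableSet A) {f g : Ω → ENNReal} (hf : Measurable f)
    {f₀ g₀ : ENNReal} (hf₀ : ∀ y ∈ A, f y = f₀) (hg₀ : ∀ y ∈ A, g y = g₀) {G : ℝ} (hG : 0 ≤ G)
    (hgood : ∀ l : ℝ, 0 < l → f₀ ≤ ENNReal.ofReal l * g₀ + ENNReal.ofReal (G / l ^ m))
    (hbad : ∀ y ∉ A, ∀ l : ℝ, 0 < l →
      f y ≤ ENNReal.ofReal l * g y + ENNReal.ofReal (Real.exp (-κ) * G / l ^ m))
    {l : ℝ} (hl : 0 < l) :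
    ∫⁻ y, f y ∂P ≤ ENNReal.ofReal l * ∫⁻ y, g y ∂Q + ENNReal.ofReal (G / l ^ m) := by
  have hxpos : ∀ y, 0 < x y := fun y => (Real.exp_pos _).trans_le (hlo y)
  have hreal : ∀ B, MeasurableSet B → P.real B = ∫ y in B, x y ∂Q := fun B hB => by
    rw [hPQ]; exact measureReal_withDensity_ofReal hx (fun y => (hxpos y).le) hB
  obtain ⟨a, halo, hahi, ha⟩ := exists_ratio hx hη hlo hhi (hreal A hA)
  have hapos : 0 < a := (Real.exp_pos _).trans_le halo
  have hmom := round_moment_le_one hx hη (Nat.le_add_left 1 m) hκ hκ1 hlo hhi hreal hA halo hahi ha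
  set I := ∫ y in Aᶜ, x y ^ (m + 1) ∂Q with hI
  have hI0 : 0 ≤ I := integral_nonneg fun y => pow_nonneg (hxpos y).le _
  have hintM : Integrable (fun y => x y ^ (m + 1)) (Q.restrict Aᶜ) := by
    refine Integrable.of_bound (hx.pow_const _).aestronglyMeasurable (Real.exp η ^ (m + 1))
      (Filter.Eventually.of_forall fun y => ?_)
    rw [norm_pow, Real.norm_of_nonneg (hxpos y).le]
    exact pow_le_pow_left₀ (hxpos y).le (hhi y) _
  -- Both integrands are constant on `A`, so only the merged ratio `a` enters. On `Aᶜ` the pointwise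
  -- ratio `x y` is used instead.
  have h1 : ∫⁻ y in A, f y ∂P ≤ ENNReal.ofReal l * ∫⁻ y in A, g y ∂Q +
      ENNReal.ofReal (G / l ^ m * (Q.real A * a ^ (m + 1))) := by
    have hPA : P A = ENNReal.ofReal a * Q A := by
      rw [← ofReal_measureReal (μ := P), ha, ENNReal.ofReal_mul hapos.le, ofReal_measureReal]
    rw [setLIntegral_congr_fun hA hf₀, setLIntegral_congr_fun hA hg₀, lintegral_const,
      lintegral_const, Measure.restrict_apply_univ, Measure.restrict_apply_univ, hPA]
    calc f₀ * (ENNReal.ofReal a * Q A) = ENNReal.ofReal a * f₀ * Q A := by ring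
      _ ≤ (ENNReal.ofReal l * g₀ + ENNReal.ofReal (G / l ^ m * a ^ (m + 1))) * Q A :=
        mul_le_mul_left (ofReal_mul_le_of_forall hgood hapos hl) _
      _ = ENNReal.ofReal l * (g₀ * Q A) +
          ENNReal.ofReal (G / l ^ m * a ^ (m + 1)) * ENNReal.ofReal (Q.real A) := by
        rw [ofReal_measureReal]; ring
      _ = _ := by
        rw [← ENNReal.ofReal_mul (by positivity)]; congr 2; ring
  have h2 : ∫⁻ y in Aᶜ, f y ∂P ≤ ENNReal.ofReal l * ∫⁻ y in Aᶜ, g y ∂Q +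
      ENNReal.ofReal (G / l ^ m * (Real.exp (-κ) * I)) := by
    rw [hPQ, restrict_withDensity hA.compl,
      lintegral_withDensity_eq_lintegral_mul _ hx.ennreal_ofReal hf]
    calc ∫⁻ y in Aᶜ, ENNReal.ofReal (x y) * f y ∂Q
        ≤ ∫⁻ y in Aᶜ, (ENNReal.ofReal l * g y +
          ENNReal.ofReal (Real.exp (-κ) * G / l ^ m * x y ^ (m + 1))) ∂Q := by
          refine setLIntegral_mono' hA.compl fun y hy => ?_
          exact ofReal_mul_le_of_forall (hbad y hy) (hxpos y) hl
      _ = ENNReal.ofReal l * ∫⁻ y in Aᶜ, g y ∂Q +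
          ENNReal.ofReal (Real.exp (-κ) * G / l ^ m * I) := by
          rw [lintegral_add_right _ (by fun_prop), lintegral_const_mul' _ _ ENNReal.ofReal_ne_top,
            ← ofReal_integral_eq_lintegral_ofReal (hintM.const_mul _)
              (Filter.Eventually.of_forall fun y => by
                have := hxpos y
                positivity), integral_const_mul]
      _ = _ := by congr 2; ring
  rw [← lintegral_add_compl f hA, ← lintegral_add_compl (μ := Q) g hA, mul_add]
  refine (add_le_add h1 h2).trans ?_
  rw [add_add_add_comm, ← ENNReal.ofReal_add (by positivity) (by positivity), ← mul_add]
  gcongr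
  rw [← mul_add]
  exact mul_le_of_le_one_right (by positivity) hmom

end Round

/-! ### The Laplace distribution -/

/-- The Laplace distribution of scale `b` shifted by `a`. -/
noncomputable def shiftedLaplace (a b : ℝ) : Measure ℝ := (laplace b).map (a + ·)

lemma isProbabilityMeasure_laplace {b : ℝ} (hb : 0 < b) : IsProbabilityMeasure (laplace b) := by
  have h1 : ∫ x : ℝ, Real.exp (-|x| / b) / (2 * b) = 1 := by
    have h := integral_comp_abs (f := fun x : ℝ => Real.exp (-(1 / b) * x))
    rw [integral_exp_mul_Ioi (by simpa using hb)] at h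
    have h2 : ∀ x : ℝ, -|x| / b = -(1 / b) * |x| := fun x => by ring
    simp_rw [integral_div, h2, h]
    simp
    exact hb.ne'
  -- A non-integrable function would have Bochner integral `0`.
  have hint : Integrable fun x : ℝ => Real.exp (-|x| / b) / (2 * b) :=
    .of_integral_ne_zero (by rw [h1]; exact one_ne_zero)
  refine ⟨?_⟩
  rw [laplace, withDensity_apply _ MeasurableSet.univ, Measure.restrict_univ,
    ← ofReal_integral_eq_lintegral_ofReal hint
      (Filter.Eventually.of_forall fun x => by positivity), h1, ENNReal.ofReal_one]

lemma isProbabilityMeasure_shiftedLaplace {b : ℝ} (hb : 0 < b) (a : ℝ) :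
    IsProbabilityMeasure (shiftedLaplace a b) :=
  have := isProbabilityMeasure_laplace hb
  Measure.isProbabilityMeasure_map (by fun_prop)

lemma shiftedLaplace_eq (a b : ℝ) : shiftedLaplace a b =
    volume.withDensity fun y => ENNReal.ofReal (Real.exp (-|y - a| / b) / (2 * b)) := by
  ext S hS
  have hm : Measurable (a + · : ℝ → ℝ) := by fun_prop
  rw [shiftedLaplace, Measure.map_apply hm hS, laplace, withDensity_apply _ (hm hS),
    withDensity_apply _ hS,
    ← (measurePreserving_add_left volume a).setLIntegral_comp_preimage hS (by fun_prop)]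
  simp

/-- The normalizing factors cancel. For `b > 0` the triangle inequality bounds the exponent by `|a -
a'| / b` at every point, as `round_bound` requires. -/
lemma shiftedLaplace_eq_withDensity (a a' b : ℝ) : shiftedLaplace a b =
    (shiftedLaplace a' b).withDensity
      fun y => ENNReal.ofReal (Real.exp ((|y - a'| - |y - a|) / b)) := by
  rw [shiftedLaplace_eq, shiftedLaplace_eq, ← withDensity_mul _ (by fun_prop) (by fun_prop)]
  congr 1
  ext y
  rw [Pi.mul_apply, mul_comm (ENNReal.ofReal _), ← ENNReal.ofReal_mul (Real.exp_pos _).le, ← mul_div_assoc,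
    ← Real.exp_add]
  congr 4
  ring


/-! ### Measurability -/

lemma measurableSet_answers_iff {S : Set Answers} :
    MeasurableSet S ↔ ∀ m, MeasurableSet {v : Fin m → ℝ | (⟨m, v⟩ : Answers) ∈ S} :=
  MeasurableSpace.measurableSet_iInf

lemma measurable_answers_mk (m : ℕ) : Measurable fun v : Fin m → ℝ => (⟨m, v⟩ : Answers) :=
  fun _ hS => measurableSet_answers_iff.1 hS m

lemma measurableSet_length_eq (m : ℕ) : MeasurableSet {a : Answers | a.1 = m} := by
  rw [measurableSet_answers_iff]
  intro j
  exact MeasurableSet.const (j = m)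

/-- The entries of a sequence of answers of length `m`, and zero for other lengths. -/
noncomputable def Answers.entries (m : ℕ) (a : Answers) : Fin m → ℝ :=
  fun i => if h : i.1 < a.1 then a.2 ⟨i.1, h⟩ else 0

lemma Answers.entries_mk {m : ℕ} (v : Fin m → ℝ) : Answers.entries m ⟨m, v⟩ = v := by
  funext i
  simp [Answers.entries]

lemma measurable_entries (m : ℕ) : Measurable (Answers.entries m) := by
  refine measurable_pi_iff.2 fun i S hS => ?_
  rw [measurableSet_answers_iff]
  intro j
  have : Measurable fun v : Fin j → ℝ => Answers.entries m ⟨j, v⟩ i := by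
    unfold Answers.entries
    by_cases h : i.1 < j
    · simp only [h, dif_pos]; exact measurable_pi_apply (X := fun _ : Fin j => ℝ) ⟨i.1, h⟩
    · simp only [h, dif_neg, not_false_eq_true]; fun_prop
  exact this hS

/-- On answers of length `m` the map agrees with one built from `Answers.entries m`, which is
defined and measurable on all of `Answers`; countably many such slices are glued. -/
lemma measurable_cons : Measurable fun w : ℝ × Answers => Answers.cons w.1 w.2 := by
  intro S hS
  have hc : ∀ m, Measurable fun w : ℝ × Answers =>
      (⟨m + 1, Fin.cons w.1 (w.2.entries m)⟩ : Answers) := fun m => by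
    refine (measurable_answers_mk (m + 1)).comp (measurable_pi_iff.2 fun i => ?_)
    refine Fin.cases ?_ (fun j => ?_) i
    · exact measurable_fst
    · exact (measurable_pi_iff.1 (measurable_entries m) j).comp measurable_snd
  have : (fun w : ℝ × Answers => Answers.cons w.1 w.2) ⁻¹' S =
      ⋃ m, {w | w.2.1 = m} ∩ (fun w : ℝ × Answers =>
        (⟨m + 1, Fin.cons w.1 (w.2.entries m)⟩ : Answers)) ⁻¹' S := by
    ext ⟨y, a⟩
    rcases a with ⟨m, v⟩
    simp [Answers.cons, Answers.entries_mk]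
  rw [this]
  exact .iUnion fun m => (measurable_snd (measurableSet_length_eq m)).inter (hc m hS)

lemma measurable_cons_left (y : ℝ) : Measurable (Answers.cons y) :=
  measurable_cons.comp (by fun_prop : Measurable fun a : Answers => (y, a))

section Kernels

variable {Ω Ω' R : Type*} [MeasurableSpace Ω] [MeasurableSpace Ω'] [MeasurableSpace R]

lemma measurable_map_cons {μ : Ω → Measure Answers} (hμ : Measurable μ)
    (hp : ∀ w, IsProbabilityMeasure (μ w)) {h : Ω → ℝ} (hh : Measurable h) :
    Measurable fun w => (μ w).map (Answers.cons (h w)) := by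
  refine Measure.measurable_of_measurable_coe _ fun S hS => ?_
  let κ : ProbabilityTheory.Kernel Ω Answers := ⟨μ, hμ⟩
  have : ProbabilityTheory.IsMarkovKernel κ := ⟨hp⟩
  have hm : Measurable fun w : Ω × Answers => Answers.cons (h w.1) w.2 :=
    measurable_cons.comp ((hh.comp measurable_fst).prodMk measurable_snd)
  have := ProbabilityTheory.Kernel.measurable_kernel_prodMk_left (κ := κ) (hm hS)
  convert this using 2 with w
  rw [Measure.map_apply (measurable_cons_left _) hS]
  rfl

lemma measurable_bind_right {ν : Measure Ω'} [SFinite ν] {F : Ω → Ω' → Measure R}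
    (hF : Measurable fun w : Ω × Ω' => F w.1 w.2) : Measurable fun w => ν.bind (F w) := by
  refine Measure.measurable_of_measurable_coe _ fun S hS => ?_
  have : ∀ w, ν.bind (F w) S = ∫⁻ z, F w z S ∂ν := fun w =>
    Measure.bind_apply hS (hF.comp measurable_prodMk_left).aemeasurable
  simp_rw [this]
  exact ((Measure.measurable_coe hS).comp hF).lintegral_prod_right'

lemma isProbabilityMeasure_bind_of_measurable {ν : Measure Ω} [IsProbabilityMeasure ν]
    {F : Ω → Measure R} (hF : Measurable F) (hp : ∀ w, IsProbabilityMeasure (F w)) :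
    IsProbabilityMeasure (ν.bind F) := by
  refine ⟨?_⟩
  rw [Measure.bind_apply .univ hF.aemeasurable]
  simp

end Kernels

/-! ### The mechanism as a measurable family of probability laws -/

section Run

variable {X : Type*} [Fintype X]

lemma sum_prod_ofReal {m : ℕ} {p : X → ℝ} (hp : ∀ x, 0 ≤ p x) (hp1 : ∑ x, p x = 1) :
    ∑ h : Fin m → X, ENNReal.ofReal (∏ j, p (h j)) = 1 := by
  classical
  rw [← ENNReal.ofReal_sum_of_nonneg fun h _ => Finset.prod_nonneg fun j _ => hp _,
    ← Fintype.piFinset_univ, ← Finset.prod_univ_sum]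
  simp [hp1]

lemma isProbabilityMeasure_withSamples {R : Type*} [MeasurableSpace R] {m : ℕ} {p : X → ℝ}
    (hp : ∀ x, 0 ≤ p x) (hp1 : ∑ x, p x = 1) {F : (Fin m → X) → Measure R}
    (hF : ∀ h, IsProbabilityMeasure (F h)) : IsProbabilityMeasure (withSamples m p F) := by
  refine ⟨?_⟩
  simp [withSamples, sum_prod_ofReal hp hp1]

lemma mwUpdate_pos [Nonempty X] (c : Config) (U : Finset (X → ℝ)) {p : X → ℝ}
    (hp : ∀ x, 0 < p x) (x : X) : 0 < mwUpdate c U p x := by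
  unfold mwUpdate
  refine div_pos (mul_pos (Real.exp_pos _) (hp x)) ?_
  exact Finset.sum_pos (fun y _ => mul_pos (Real.exp_pos _) (hp y)) Finset.univ_nonempty

lemma sum_mwUpdate [Nonempty X] (c : Config) (U : Finset (X → ℝ)) {p : X → ℝ}
    (hp : ∀ x, 0 < p x) : ∑ x, mwUpdate c U p x = 1 := by
  unfold mwUpdate
  rw [← Finset.sum_div]
  refine div_self (ne_of_gt ?_)
  exact Finset.sum_pos (fun y _ => mul_pos (Real.exp_pos _) (hp y)) Finset.univ_nonempty

variable {n : ℕ}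

/-- The law of the remaining answers after a bad round, when `U` is the enlarged set of update
queries. -/
noncomputable def afterBadRound (c : Config) (D : Fin n → X) (qs : List (X → ℝ)) (p H : X → ℝ)
    (t r : ℕ) (U : Finset (X → ℝ)) (s : ℝ) : Measure Answers :=
  if s < U.card then
    withSamples c.numSamples (mwUpdate c U p) fun h =>
      (laplace (2 / c.eps)).bind fun y =>
        run c D qs (mwUpdate c U p) (empirical h) ∅ (c.batch + y) (t + 1) (r + 1)
  else run c D qs p H U s t (r + 1)

/-- The update query that a bad round with noisy answer `y` contributes. -/
noncomputable def updateQuery (q H : X → ℝ) (y : ℝ) : X → ℝ :=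
  fun x => Real.sign (evalDist q H - y) * q x

open Classical in
/-- The law of the answers from a round with query `q` and noisy answer `y` on. -/
noncomputable def afterNoisyAnswer (c : Config) (D : Fin n → X) (q : X → ℝ) (qs : List (X → ℝ))
    (p H : X → ℝ) (U : Finset (X → ℝ)) (t r : ℕ) (s y : ℝ) : Measure Answers :=
  if |y - evalDist q H| ≤ c.threshold then
    (run c D qs p H U s t r).map (Answers.cons (evalDist q H))
  else (afterBadRound c D qs p H t r (insert (updateQuery q H y) U) s).map (Answers.cons y)

/-- Expressing the round through the noisy answer `y` instead of the noise confines the database to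
the law of `y` and the later rounds, so two databases can be compared at the same `y`. -/
lemma run_cons (c : Config) (D : Fin n → X) (q : X → ℝ) (qs : List (X → ℝ))
    (p H : X → ℝ) (U : Finset (X → ℝ)) (s : ℝ) (t r : ℕ) :
    run c D (q :: qs) p H U s t r =
      if (t : ℝ) < c.maxEpochs ∧ (r : ℝ) < c.maxBad then
        (laplace c.noise).bind fun z =>
          afterNoisyAnswer c D q qs p H U t r s (evalDatabase q D + z)
      else Measure.dirac Answers.nil := by
  rw [run]
  have hu : ∀ z, updateQuery q H (evalDatabase q D + z) =
      fun x => Real.sign (evalDist q H - evalDatabase q D - z) * q x := fun z => by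
    funext x
    rw [updateQuery, sub_add_eq_sub_sub]
  simp only [afterNoisyAnswer, afterBadRound, hu, add_sub_right_comm]

/-- The law of the answers from some state on is a probability law that depends measurably on the
noisy batch size. -/
def IsRegular (c : Config) (D : Fin n → X) (qs : List (X → ℝ)) : Prop :=
  ∀ (p H : X → ℝ) (U : Finset (X → ℝ)) (t r : ℕ), (∀ x, 0 < p x) →
    Measurable (fun s => run c D qs p H U s t r) ∧
      ∀ s, IsProbabilityMeasure (run c D qs p H U s t r)

variable {c : Config} {D : Fin n → X} {qs : List (X → ℝ)}

lemma IsRegular.isProbabilityMeasure_afterBadRound [Nonempty X] (h : IsRegular c D qs)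
    (hε : 0 < c.eps) {p : X → ℝ} (hp : ∀ x, 0 < p x) (H : X → ℝ) (t r : ℕ)
    (U : Finset (X → ℝ)) (s : ℝ) : IsProbabilityMeasure (afterBadRound c D qs p H t r U s) := by
  have := isProbabilityMeasure_laplace (div_pos two_pos hε)
  unfold afterBadRound
  split_ifs
  · refine isProbabilityMeasure_withSamples (fun x => (mwUpdate_pos c U hp x).le)
      (sum_mwUpdate c U hp) fun k => ?_
    have hk := h _ (empirical k) ∅ (t + 1) (r + 1) (mwUpdate_pos c U hp)
    exact isProbabilityMeasure_bind_of_measurable (hk.1.comp (measurable_const_add _))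
      fun y => hk.2 _
  · exact (h p H U t (r + 1) hp).2 s

lemma IsRegular.measurable_afterBadRound (h : IsRegular c D qs) {p : X → ℝ}
    (hp : ∀ x, 0 < p x) (H : X → ℝ) (t r : ℕ) (U : Finset (X → ℝ)) :
    Measurable (afterBadRound c D qs p H t r U) := by
  unfold afterBadRound
  -- Closing an epoch discards the old batch size, so that branch is constant in `s`.
  exact Measurable.ite (measurableSet_lt measurable_id measurable_const) measurable_const
    (h p H U t (r + 1) hp).1

lemma IsRegular.isProbabilityMeasure_afterNoisyAnswer [Nonempty X] (h : IsRegular c D qs)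
    (hε : 0 < c.eps) {p : X → ℝ} (hp : ∀ x, 0 < p x) (q H : X → ℝ) (U : Finset (X → ℝ)) (t r : ℕ)
    (s y : ℝ) : IsProbabilityMeasure (afterNoisyAnswer c D q qs p H U t r s y) := by
  unfold afterNoisyAnswer
  split_ifs
  · have := (h p H U t r hp).2 s
    exact Measure.isProbabilityMeasure_map (measurable_cons_left _).aemeasurable
  · have := h.isProbabilityMeasure_afterBadRound hε hp H t r (insert (updateQuery q H y) U) s
    exact Measure.isProbabilityMeasure_map (measurable_cons_left _).aemeasurable

open Classical in
lemma IsRegular.measurable_afterNoisyAnswer [Nonempty X] (h : IsRegular c D qs)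
    (hε : 0 < c.eps) {p : X → ℝ} (hp : ∀ x, 0 < p x) (q H : X → ℝ) (U : Finset (X → ℝ))
    (t r : ℕ) :
    Measurable fun w : ℝ × ℝ => afterNoisyAnswer c D q qs p H U t r w.1 w.2 := by
  have hbad : ∀ u : X → ℝ, Measurable fun w : ℝ × ℝ =>
      (afterBadRound c D qs p H t r (insert u U) w.1).map (Answers.cons w.2) := fun u =>
    measurable_map_cons ((h.measurable_afterBadRound hp H t r _).comp measurable_fst)
      (fun w => h.isProbabilityMeasure_afterBadRound hε hp H t r _ _) measurable_snd
  unfold afterNoisyAnswer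
  refine Measurable.ite (measurableSet_le (by fun_prop) measurable_const)
    ((Measure.measurable_map _ (measurable_cons_left _)).comp
      ((h p H U t r hp).1.comp measurable_fst)) ?_
  -- The update query depends on the noisy answer only through a sign, so three fixed queries cover
  -- all cases.
  have : (fun w : ℝ × ℝ => (afterBadRound c D qs p H t r
        (insert (updateQuery q H w.2) U) w.1).map (Answers.cons w.2)) =
      fun w : ℝ × ℝ => if evalDist q H - w.2 < 0 then
        (afterBadRound c D qs p H t r (insert (fun x => -1 * q x) U) w.1).map (Answers.cons w.2)
      else if 0 < evalDist q H - w.2 then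
        (afterBadRound c D qs p H t r (insert (fun x => 1 * q x) U) w.1).map (Answers.cons w.2)
      else
        (afterBadRound c D qs p H t r (insert (fun x => 0 * q x) U) w.1).map
          (Answers.cons w.2) := by
    ext1 w
    unfold updateQuery Real.sign
    split_ifs <;> rfl
  rw [this]
  exact Measurable.ite (measurableSet_lt (by fun_prop) measurable_const) (hbad _)
    (Measurable.ite (measurableSet_lt measurable_const (by fun_prop)) (hbad _) (hbad _))

lemma isRegular_of_pos [Nonempty X] (c : Config) (hε : 0 < c.eps) (hσ : 0 < c.noise)
    (D : Fin n → X) (qs : List (X → ℝ)) : IsRegular c D qs := by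
  have := isProbabilityMeasure_laplace hσ
  induction qs with
  | nil =>
    intro p H U t r _
    simp only [run]
    exact ⟨measurable_const, fun _ => inferInstance⟩
  | cons q qs ih =>
    intro p H U t r hp
    simp only [run_cons]
    split_ifs
    · have hm := ih.measurable_afterNoisyAnswer hε hp q H U t r
      have hm' : Measurable fun w : ℝ × ℝ =>
          afterNoisyAnswer c D q qs p H U t r w.1 (evalDatabase q D + w.2) :=
        hm.comp (g := fun w : ℝ × ℝ => afterNoisyAnswer c D q qs p H U t r w.1 w.2)
          (f := fun w : ℝ × ℝ => (w.1, evalDatabase q D + w.2)) (by fun_prop)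
      refine ⟨measurable_bind_right
        (F := fun s z => afterNoisyAnswer c D q qs p H U t r s (evalDatabase q D + z)) hm',
        fun s => ?_⟩
      have hs : Measurable fun z =>
          afterNoisyAnswer c D q qs p H U t r s (evalDatabase q D + z) :=
        hm.comp (g := fun w : ℝ × ℝ => afterNoisyAnswer c D q qs p H U t r w.1 w.2)
          (f := fun z : ℝ => (s, evalDatabase q D + z)) (by fun_prop)
      exact isProbabilityMeasure_bind_of_measurable hs fun z => ih.isProbabilityMeasure_afterNoisyAnswer hε hp q H U t r _ _
    · exact ⟨measurable_const, fun _ => inferInstance⟩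

/-- Needed for a one-point universe, where the noise scale is `0` and `laplace 0` is the zero
measure: the run halts before drawing from it. -/
lemma isRegular_of_maxEpochs_nonpos (c : Config) (hT : c.maxEpochs ≤ 0)
    (D : Fin n → X) (qs : List (X → ℝ)) : IsRegular c D qs := by
  intro p H U t r _
  have : ∀ s, run c D qs p H U s t r = Measure.dirac Answers.nil := by
    intro s
    cases qs with
    | nil => simp only [run]
    | cons q qs =>
      rw [run_cons, if_neg]
      rintro ⟨h, -⟩
      have := Nat.cast_nonneg (α := ℝ) t
      linarith
  simp only [this]
  exact ⟨measurable_const, fun _ => inferInstance⟩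

end Run


/-! ### Hockey-stick bounds -/

/-- For every multiplier `l`, the law `μ` is dominated by `l` times `ν` up to an error `G / l ^ m`.
This is what a bound on a Rényi divergence of order `m + 1` gives. -/
def IsDominated {R : Type*} [MeasurableSpace R] (G : ℝ) (m : ℕ) (μ ν : Measure R) : Prop :=
  ∀ S, MeasurableSet S → ∀ l : ℝ, 0 < l →
    μ S ≤ ENNReal.ofReal l * ν S + ENNReal.ofReal (G / l ^ m)

namespace IsDominated

variable {R R' : Type*} [MeasurableSpace R] [MeasurableSpace R'] {G : ℝ} {m : ℕ}

lemma refl (hG : 1 ≤ G) (μ : Measure R) [IsProbabilityMeasure μ] : IsDominated G m μ μ := by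
  intro S _ l hl
  rcases le_total 1 l with h | h
  · refine le_add_right (le_mul_of_one_le_left' ?_)
    rwa [ENNReal.one_le_ofReal]
  -- For `l ≤ 1` the error term alone is at least `1`.
  · refine le_add_left (prob_le_one.trans ?_)
    rw [ENNReal.one_le_ofReal, le_div_iff₀ (by positivity), one_mul]
    exact (pow_le_one₀ hl.le h).trans hG

lemma map {μ ν : Measure R} (h : IsDominated G m μ ν) {f : R → R'} (hf : Measurable f) :
    IsDominated G m (μ.map f) (ν.map f) := by
  intro S hS l hl
  rw [Measure.map_apply hf hS, Measure.map_apply hf hS]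
  exact h _ (hf hS) l hl

/-- Randomness with a common law costs nothing, since the bound is linear in the pair of measures
and the error averages to itself. -/
lemma bind {Ω : Type*} [MeasurableSpace Ω] {ρ : Measure Ω} [IsProbabilityMeasure ρ]
    {μ ν : Ω → Measure R} (hμ : Measurable μ) (hν : Measurable ν)
    (h : ∀ w, IsDominated G m (μ w) (ν w)) : IsDominated G m (ρ.bind μ) (ρ.bind ν) := by
  intro S hS l hl
  rw [Measure.bind_apply hS hμ.aemeasurable, Measure.bind_apply hS hν.aemeasurable]
  calc ∫⁻ w, μ w S ∂ρ ≤ ∫⁻ w, (ENNReal.ofReal l * ν w S + ENNReal.ofReal (G / l ^ m)) ∂ρ :=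
        lintegral_mono fun w => h w S hS l hl
    _ = _ := by
      rw [lintegral_add_right _ measurable_const,
        lintegral_const_mul' _ _ ENNReal.ofReal_ne_top]
      simp

lemma withSamples {X : Type*} [Fintype X] {k : ℕ} {p : X → ℝ} (hp : ∀ x, 0 ≤ p x)
    (hp1 : ∑ x, p x = 1) {F F' : (Fin k → X) → Measure R}
    (h : ∀ v, IsDominated G m (F v) (F' v)) :
    IsDominated G m (withSamples k p F) (withSamples k p F') := by
  intro S hS l hl
  simp only [OnlineQueryRelease.withSamples, Measure.coe_finsetSum, Finset.sum_apply,
    Measure.smul_apply, smul_eq_mul]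
  calc ∑ v : Fin k → X, ENNReal.ofReal (∏ j, p (v j)) * F v S
      ≤ ∑ v : Fin k → X, ENNReal.ofReal (∏ j, p (v j)) *
          (ENNReal.ofReal l * F' v S + ENNReal.ofReal (G / l ^ m)) :=
        Finset.sum_le_sum fun v _ => mul_le_mul_right (h v S hS l hl) _
    _ = _ := by
      simp only [mul_add, Finset.sum_add_distrib, ← Finset.sum_mul, sum_prod_ofReal hp hp1,
        one_mul, Finset.mul_sum, mul_left_comm (ENNReal.ofReal l)]

end IsDominated

/-! ### The run of the mechanism on two databases -/

section Run

variable {X : Type*} [Fintype X] [Nonempty X] {n : ℕ} {c : Config} {D D' : Fin n → X}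

/-- Both runs share `U` and `s`, hence take the same branch, and a new hypothesis and batch size are
drawn from laws free of the database. -/
lemma isDominated_afterBadRound {qs : List (X → ℝ)} (hε : 0 < c.eps)
    (hD : IsRegular c D qs) (hD' : IsRegular c D' qs) {G : ℝ} {m r : ℕ}
    (h : ∀ (p H : X → ℝ) (U : Finset (X → ℝ)) (s : ℝ) (t : ℕ), (∀ x, 0 < p x) →
      IsDominated G m (run c D qs p H U s t (r + 1)) (run c D' qs p H U s t (r + 1)))
    {p : X → ℝ} (hp : ∀ x, 0 < p x) (H : X → ℝ) (t : ℕ) (U : Finset (X → ℝ)) (s : ℝ) :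
    IsDominated G m (afterBadRound c D qs p H t r U s) (afterBadRound c D' qs p H t r U s) := by
  have := isProbabilityMeasure_laplace (div_pos two_pos hε)
  unfold afterBadRound
  split_ifs
  · have hp' := mwUpdate_pos c U hp
    refine .withSamples (fun x => (hp' x).le) (sum_mwUpdate c U hp) fun v => ?_
    exact .bind ((hD _ (empirical v) ∅ (t + 1) (r + 1) hp').1.comp (measurable_const_add _))
      ((hD' _ (empirical v) ∅ (t + 1) (r + 1) hp').1.comp (measurable_const_add _))
      fun y => h _ _ _ _ _ hp'
  · exact h _ _ _ _ _ hp

-- The constant is the budget for the bad rounds still possible: a good round keeps it, a bad one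
-- multiplies it by `exp (-κ)`. The `+ 1` is there because `r < maxBad` is tested before `r`
-- increases, so `r` may end just below `maxBad + 1`.
open Classical in
lemma isDominated_run (hε : 0 < c.eps) (hσ : 0 < c.noise) {η κ : ℝ} {m : ℕ} (hη : 0 ≤ η)
    (hκ : κ = 144 * ((m + 1 : ℕ) * η) ^ 2) (hκ1 : κ ≤ 1) (qs : List (X → ℝ))
    (hqs : ∀ q ∈ qs, |evalDatabase q D - evalDatabase q D'| ≤ η * c.noise) :
    ∀ (r : ℕ), (r : ℝ) ≤ c.maxBad + 1 →
    ∀ (p H : X → ℝ) (U : Finset (X → ℝ)) (s : ℝ) (t : ℕ), (∀ x, 0 < p x) →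
      IsDominated (Real.exp (κ * (c.maxBad + 1 - r))) m
        (run c D qs p H U s t r) (run c D' qs p H U s t r) := by
  have hκ0 : 0 ≤ κ := by rw [hκ]; positivity
  have hnil : ∀ r : ℕ, (r : ℝ) ≤ c.maxBad + 1 →
      IsDominated (Real.exp (κ * (c.maxBad + 1 - r))) m
        (Measure.dirac Answers.nil) (Measure.dirac Answers.nil) := fun r hr =>
    .refl (Real.one_le_exp (mul_nonneg hκ0 (by linarith))) _
  induction qs with
  | nil =>
    intro r hr p H U s t _
    simp only [run]
    exact hnil r hr
  | cons q qs ih =>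
    intro r hr p H U s t hp
    have ih' := ih fun q' hq' => hqs q' (List.mem_cons_of_mem _ hq')
    have hq := hqs q List.mem_cons_self
    have hD := isRegular_of_pos c hε hσ D qs
    have hD' := isRegular_of_pos c hε hσ D' qs
    rw [run_cons, run_cons]
    split_ifs with hc
    swap
    · exact hnil r hr
    intro S hS l hl
    have hF : ∀ {E : Fin n → X}, IsRegular c E qs →
        Measurable fun y => afterNoisyAnswer c E q qs p H U t r s y := fun h =>
      (h.measurable_afterNoisyAnswer hε hp q H U t r).comp
        (g := fun w : ℝ × ℝ => afterNoisyAnswer c _ q qs p H U t r w.1 w.2)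
        (f := fun y : ℝ => (s, y)) measurable_prodMk_left
    have hbind : ∀ {E : Fin n → X}, IsRegular c E qs →
        (laplace c.noise).bind (fun z =>
          afterNoisyAnswer c E q qs p H U t r s (evalDatabase q E + z)) S =
        ∫⁻ y, afterNoisyAnswer c E q qs p H U t r s y S
          ∂(shiftedLaplace (evalDatabase q E) c.noise) := fun {E} h => by
      have hm : Measurable fun z =>
          afterNoisyAnswer c E q qs p H U t r s (evalDatabase q E + z) :=
        (hF h).comp (measurable_const_add _)
      rw [Measure.bind_apply hS hm.aemeasurable, shiftedLaplace,
        lintegral_map (f := fun y => afterNoisyAnswer c E q qs p H U t r s y S)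
          ((Measure.measurable_coe hS).comp (hF h)) (measurable_const_add _)]
    rw [hbind hD, hbind hD']
    have := isProbabilityMeasure_shiftedLaplace hσ (evalDatabase q D)
    have := isProbabilityMeasure_shiftedLaplace hσ (evalDatabase q D')
    have hx : ∀ y, |(|y - evalDatabase q D'| - |y - evalDatabase q D|) / c.noise| ≤ η := by
      intro y
      rw [abs_div, abs_of_pos hσ, div_le_iff₀ hσ]
      refine (abs_abs_sub_abs_le_abs_sub _ _).trans ?_
      rwa [sub_sub_sub_cancel_left]
    refine round_bound
      (x := fun y => Real.exp ((|y - evalDatabase q D'| - |y - evalDatabase q D|) / c.noise))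
      (by fun_prop) hη hκ hκ1 (fun y => Real.exp_le_exp.2 (abs_le.1 (hx y)).1)
      (fun y => Real.exp_le_exp.2 (abs_le.1 (hx y)).2) (shiftedLaplace_eq_withDensity _ _ _)
      (A := {y | |y - evalDist q H| ≤ c.threshold})
      (f := fun y => afterNoisyAnswer c D q qs p H U t r s y S)
      (g := fun y => afterNoisyAnswer c D' q qs p H U t r s y S)
      (f₀ := (run c D qs p H U s t r).map (Answers.cons (evalDist q H)) S)
      (g₀ := (run c D' qs p H U s t r).map (Answers.cons (evalDist q H)) S)
      ?_ ((Measure.measurable_coe hS).comp (hF hD)) ?_ ?_ (Real.exp_pos _).le ?_ ?_ hl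
    · exact measurableSet_le (by fun_prop) measurable_const
    · intro y (hy : |y - evalDist q H| ≤ c.threshold)
      simp only [afterNoisyAnswer, if_pos hy]
    · intro y (hy : |y - evalDist q H| ≤ c.threshold)
      simp only [afterNoisyAnswer, if_pos hy]
    · exact (ih' r hr p H U s t hp).map (measurable_cons_left _) S hS
    · intro y (hy : ¬|y - evalDist q H| ≤ c.threshold)
      have hbad := isDominated_afterBadRound hε hD hD'
        (ih' (r + 1) (by push_cast; linarith [hc.2])) hp H t (insert (updateQuery q H y) U) s
      have hG : Real.exp (-κ) * Real.exp (κ * (c.maxBad + 1 - r)) =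
          Real.exp (κ * (c.maxBad + 1 - (r + 1 : ℕ))) := by
        rw [← Real.exp_add]; congr 1; push_cast; ring
      rw [hG]
      simp only [afterNoisyAnswer, if_neg hy]
      exact hbad.map (measurable_cons_left y) S hS

end Run


/-! ### Privacy of the mechanism -/

lemma abs_evalDatabase_sub_le {X : Type*} {n : ℕ} {D D' : Fin n → X} (h : Adjacent D D')
    {q : X → ℝ} (hq : ∀ x, q x ∈ Set.Icc (0 : ℝ) 1) :
    |evalDatabase q D - evalDatabase q D'| ≤ 1 / n := by
  obtain ⟨i, hi⟩ := h
  unfold evalDatabase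
  rw [← sub_div, ← Finset.sum_sub_distrib, Finset.sum_eq_single i
    (fun j _ hj => by rw [hi j hj, sub_self]) (fun h => absurd (Finset.mem_univ i) h),
    abs_div, Nat.abs_cast]
  gcongr
  rw [abs_le]
  constructor <;> linarith [(hq (D i)).1, (hq (D i)).2, (hq (D' i)).1, (hq (D' i)).2]

lemma online_maxEpochs_eq_zero (n k : ℕ) (ε δ β step : ℝ) :
    (Config.online n 1 k ε δ β step).maxEpochs = 0 := by
  simp [Config.online]

/-- The form of the budget once fractional powers are cleared. Only `b ^ 4`, which stands for `log
N`, may lie below `1`, because `log 2 < 1`. -/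
lemma budget_monomial_bound {a b c d e : ℝ} (ha : 1 ≤ a) (hb : 1 / 2 ≤ b ^ 4) (hb0 : 0 < b)
    (hc : 1 ≤ c) (hd : 1 ≤ d) (he : 0 < e) (he1 : e ≤ 1) :
    (e ^ 3 / (20000 * a ^ 3 * b ^ 3 * c * d)) ^ 2 * (256 * a ^ 6 * b ^ 6 * c ^ 2 * d ^ 2 / e ^ 2 + 1)
      ≤ e ^ 4 / 2304 := by
  have hb2 : 1 / 2 ≤ b ^ 2 := by nlinarith [sq_nonneg b]
  have hb6 : 1 / 4 ≤ b ^ 6 := by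
    calc (1 / 4 : ℝ) = 1 / 2 * (1 / 2) := by norm_num
      _ ≤ b ^ 4 * b ^ 2 := by gcongr
      _ = b ^ 6 := by ring
  have h1 : (e ^ 3 / (20000 * a ^ 3 * b ^ 3 * c * d)) ^ 2 *
      (256 * a ^ 6 * b ^ 6 * c ^ 2 * d ^ 2 / e ^ 2) = e ^ 4 * (256 / 20000 ^ 2) := by
    field_simp
  have h2 : (e ^ 3 / (20000 * a ^ 3 * b ^ 3 * c * d)) ^ 2 ≤ e ^ 4 * (4 / 20000 ^ 2) := by
    have h3 : 1 * (1 / 4) * 1 * 1 ≤ a ^ 6 * b ^ 6 * c ^ 2 * d ^ 2 := by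
      gcongr
      · exact one_le_pow₀ ha
      · exact one_le_pow₀ hc
      · exact one_le_pow₀ hd
    have h4 : e ^ 6 ≤ e ^ 4 := pow_le_pow_of_le_one he.le he1 (by norm_num)
    rw [div_pow, div_le_iff₀ (by positivity)]
    have h5 := mul_le_mul_of_nonneg_left h3 (by positivity : (0 : ℝ) ≤ e ^ 4 * 4)
    calc (e ^ 3) ^ 2 = e ^ 6 := by ring
      _ ≤ e ^ 4 * 4 * (a ^ 6 * b ^ 6 * c ^ 2 * d ^ 2) := by linarith
      _ = _ := by ring
  rw [mul_add, h1, mul_one]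
  have : 0 < e ^ 4 := by positivity
  linarith

/-! ### The numerical parameters and the privacy budget -/

section Parameters

variable {n N k : ℕ} {ε δ β step : ℝ}

lemma half_le_log (hN : 2 ≤ N) : 1 / 2 ≤ Real.log N := by
  have h1 : Real.log 2 ≤ Real.log N := Real.log_le_log two_pos (by exact_mod_cast hN)
  linarith [Real.log_two_gt_d9]

lemma one_le_log_of_four_le {x : ℝ} (hx : 4 ≤ x) : 1 ≤ Real.log x := by
  have h1 : Real.log 4 ≤ Real.log x := Real.log_le_log (by norm_num) hx
  have h2 : Real.log 4 = 2 * Real.log 2 := by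
    rw [show (4 : ℝ) = 2 ^ 2 by norm_num, Real.log_pow]; norm_num
  linarith [Real.log_two_gt_d9]

lemma four_le_div (hk : 0 < k) (hβ : 0 < β) (hβ1 : β ≤ 1) : 4 ≤ 4 * k / β := by
  have hk1 : (1 : ℝ) ≤ k := by exact_mod_cast hk
  rw [le_div_iff₀ hβ]
  nlinarith

lemma online_noise_pos (hn : 0 < n) (hk : 0 < k) (hN : 2 ≤ N) (hε : 0 < ε) (hδ : 0 < δ)
    (hδ1 : δ ≤ 1) (hβ : 0 < β) (hβ1 : β ≤ 1) :
    0 < (Config.online n N k ε δ β step).noise := by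
  have hL := half_le_log hN
  have hK := one_le_log_of_four_le (four_le_div hk hβ hβ1)
  have hl : 1 ≤ Real.log (4 / δ) := one_le_log_of_four_le (by rw [le_div_iff₀ hδ]; linarith)
  have hn' : (0 : ℝ) < n := by exact_mod_cast hn
  simp only [Config.online]
  positivity

/-- Here `2304 = 144 * 4 ^ 2`, the `4` coming from the bound `m + 1 ≤ 4 log (4/δ) / ε` on the moment
order. -/
lemma online_budget (hn : 0 < n) (hk : 0 < k) (hN : 2 ≤ N) (hε : 0 < ε) (hε1 : ε ≤ 1)
    (hδ : 0 < δ) (hδ1 : δ ≤ 1) (hβ : 0 < β) (hβ1 : β ≤ 1) :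
    0 ≤ (Config.online n N k ε δ β step).maxBad ∧
    (Real.log (4 / δ) * (1 / (n * (Config.online n N k ε δ β step).noise))) ^ 2 *
      ((Config.online n N k ε δ β step).maxBad + 1) ≤ ε ^ 2 / 2304 := by
  have hL := half_le_log hN
  have hK := one_le_log_of_four_le (four_le_div hk hβ hβ1)
  have hl : 1 ≤ Real.log (4 / δ) := one_le_log_of_four_le (by rw [le_div_iff₀ hδ]; linarith)
  have hn' : (1 : ℝ) ≤ n := by exact_mod_cast hn
  have hlog : Real.log (1 / δ) ≤ Real.log (4 / δ) :=
    Real.log_le_log (by positivity) (by gcongr; norm_num)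
  have hlog0 : 0 ≤ Real.log (1 / δ) := Real.log_nonneg (by rw [le_div_iff₀ hδ]; linarith)
  simp only [Config.online]
  generalize Real.log (1 / δ) = l' at *
  generalize Real.log (4 / δ) = l at *
  generalize Real.log (4 * k / β) = K at *
  generalize Real.log N = L at *
  generalize (n : ℝ) = ν at *
  refine ⟨by positivity, ?_⟩
  -- Fifth roots of `n`, fourth roots of the logarithms and the square root of `ε` turn every power
  -- except the square root in the batch size into an integer one.
  have root : ∀ {x : ℝ} {j : ℕ}, 0 ≤ x → j ≠ 0 → ∀ i : ℕ,
      x ^ ((i : ℝ) / j) = (x ^ (1 / (j : ℝ))) ^ i := fun hx _ i => by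
    rw [← Real.rpow_natCast, ← Real.rpow_mul hx]; congr 1; ring
  obtain ⟨a, ha, rfl⟩ : ∃ a : ℝ, 1 ≤ a ∧ a ^ 5 = ν :=
    ⟨ν ^ (1 / (5 : ℕ) : ℝ), Real.one_le_rpow hn' (by positivity), by
      rw [← root (by linarith) (by norm_num)]; norm_num⟩
  have quart : ∀ x : ℝ, 0 ≤ x → ∃ b : ℝ, 0 ≤ b ∧ b ^ 4 = x := fun x hx =>
    ⟨x ^ (1 / (4 : ℕ) : ℝ), Real.rpow_nonneg hx _, by
      rw [← root hx (by norm_num)]; norm_num⟩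
  obtain ⟨b, hb, rfl⟩ := quart L (by linarith)
  obtain ⟨c, hc, rfl⟩ := quart K (by linarith)
  obtain ⟨d, hd, rfl⟩ := quart l (by linarith)
  obtain ⟨e, he, rfl⟩ : ∃ e : ℝ, 0 ≤ e ∧ e ^ 2 = ε := ⟨√ε, Real.sqrt_nonneg _, Real.sq_sqrt hε.le⟩
  have unroot : ∀ {x : ℝ} (j i : ℕ) {s : ℝ}, 0 ≤ x → j * s = i → (x ^ j) ^ s = x ^ i :=
    fun {x} j i {s} hx h => by
      rw [← Real.rpow_natCast, ← Real.rpow_mul hx, h, Real.rpow_natCast]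
  have ha0 : 0 ≤ a := by linarith
  rw [unroot 5 2 ha0 (by norm_num), unroot 5 4 ha0 (by norm_num), unroot 4 3 hb (by norm_num),
    unroot 4 1 hc (by norm_num), unroot 4 5 hd (by norm_num), unroot 2 3 he (by norm_num)]
  have hb0 : 0 < b := by
    rcases hb.eq_or_lt with rfl | h
    · norm_num at hL
    · exact h
  have he0 : 0 < e := by
    rcases he.eq_or_lt with rfl | h
    · norm_num at hε
    · exact h
  have hc1 : 1 ≤ c := by
    by_contra! h
    exact absurd (pow_lt_one₀ hc h four_ne_zero) (not_lt.2 hK)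
  have hd1 : 1 ≤ d := by
    by_contra! h
    exact absurd (pow_lt_one₀ hd h four_ne_zero) (not_lt.2 hl)
  have he1 : e ≤ 1 := by
    by_contra! h
    exact absurd (one_lt_pow₀ h two_ne_zero) (not_lt.2 hε1)
  have hsqrt : √(b ^ 4 * c ^ 4 * l') ≤ b ^ 2 * c ^ 2 * d ^ 2 := by
    rw [Real.sqrt_le_left (by positivity)]
    calc b ^ 4 * c ^ 4 * l' ≤ b ^ 4 * c ^ 4 * d ^ 4 := by gcongr
      _ = _ := by ring
  have hη : d ^ 4 * (1 / (a ^ 5 * (20000 * b ^ 3 * c ^ 1 * d ^ 5 / (e ^ 3 * a ^ 2)))) =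
      e ^ 3 / (20000 * a ^ 3 * b ^ 3 * c * d) := by
    field_simp
  have hR : 2 * (128 * a ^ 2 * √(b ^ 4 * c ^ 4 * l') / e ^ 2) * (a ^ 4 * b ^ 4) ≤
      256 * a ^ 6 * b ^ 6 * c ^ 2 * d ^ 2 / e ^ 2 := by
    calc _ ≤ 2 * (128 * a ^ 2 * (b ^ 2 * c ^ 2 * d ^ 2) / e ^ 2) * (a ^ 4 * b ^ 4) := by gcongr
      _ = _ := by ring
  rw [hη]
  calc _ ≤ (e ^ 3 / (20000 * a ^ 3 * b ^ 3 * c * d)) ^ 2 *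
        (256 * a ^ 6 * b ^ 6 * c ^ 2 * d ^ 2 / e ^ 2 + 1) := by gcongr
    _ ≤ e ^ 4 / 2304 := budget_monomial_bound ha hL hb0 hc1 hd1 he0 he1
    _ = _ := by ring

end Parameters

lemma isProbabilityMeasure_mechanism {X : Type*} [Fintype X] [Nonempty X] {n k : ℕ} {c : Config}
    (hε : 0 < c.eps) (q : Fin k → X → ℝ) {D : Fin n → X} (h : IsRegular c D (List.ofFn q)) :
    IsProbabilityMeasure (mechanism c q D) := by
  have := isProbabilityMeasure_laplace (div_pos two_pos hε)
  have hr := h (uniform X) (uniform X) ∅ 0 0 fun _ => by unfold uniform; positivity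
  exact isProbabilityMeasure_bind_of_measurable (hr.1.comp (measurable_const_add _))
    fun _ => hr.2 _

lemma mechanism_le {X : Type*} [Fintype X] [Nonempty X] {n k : ℕ} (hn : 0 < n) {c : Config}
    {δ : ℝ} (hε : 0 < c.eps) (hε1 : c.eps ≤ 1) (hδ : 0 < δ) (hδ1 : δ ≤ 1) (hσ : 0 < c.noise)
    (hR : 0 ≤ c.maxBad)
    (hbudget : (Real.log (4 / δ) * (1 / (n * c.noise))) ^ 2 * (c.maxBad + 1) ≤ c.eps ^ 2 / 2304)
    {q : Fin k → X → ℝ} (hq : ∀ i x, q i x ∈ Set.Icc (0 : ℝ) 1) {D D' : Fin n → X}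
    (hDD' : Adjacent D D') {S : Set Answers} (hS : MeasurableSet S) :
    mechanism c q D S ≤
      ENNReal.ofReal (Real.exp c.eps) * mechanism c q D' S + ENNReal.ofReal δ := by
  have hn' : (0 : ℝ) < n := by exact_mod_cast hn
  set ε := c.eps with hεdef
  set ℓ := Real.log (4 / δ) with hℓ
  have hℓ1 : 1 ≤ ℓ := one_le_log_of_four_le (by rw [le_div_iff₀ hδ]; linarith)
  set η := 1 / (n * c.noise) with hη
  have hη0 : 0 ≤ η := by positivity
  set m := ⌈2 * ℓ / ε⌉₊ with hm
  set κ := 144 * ((m + 1 : ℕ) * η) ^ 2 with hκ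
  have hκ0 : 0 ≤ κ := by positivity
  have hm1 : 2 * ℓ / ε ≤ m := Nat.le_ceil _
  have hm2 : ((m + 1 : ℕ) : ℝ) ≤ 4 * ℓ / ε := by
    have h1 : (m : ℝ) < 2 * ℓ / ε + 1 := Nat.ceil_lt_add_one (by positivity)
    have h2 : 1 ≤ ℓ / ε := by rw [le_div_iff₀ hε]; linarith
    push_cast
    have h3 : 4 * ℓ / ε = 4 * (ℓ / ε) := by ring
    have h4 : 2 * ℓ / ε = 2 * (ℓ / ε) := by ring
    linarith
  -- The whole budget is at most `1`, so the initial constant is at most `e`.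
  have hκR : κ * (c.maxBad + 1) ≤ 1 := by
    calc κ * (c.maxBad + 1) ≤ 144 * (4 * ℓ / ε * η) ^ 2 * (c.maxBad + 1) := by
          rw [hκ]; gcongr
      _ = 2304 / ε ^ 2 * ((ℓ * η) ^ 2 * (c.maxBad + 1)) := by field_simp; ring
      _ ≤ 2304 / ε ^ 2 * (ε ^ 2 / 2304) := by gcongr
      _ = 1 := by field_simp
  have hκ1 : κ ≤ 1 := by nlinarith
  have hu : ∀ x, 0 < uniform X x := fun _ => by unfold uniform; positivity
  have := isProbabilityMeasure_laplace (div_pos two_pos hε)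
  have hqs : ∀ f ∈ List.ofFn q, |evalDatabase f D - evalDatabase f D'| ≤ η * c.noise := by
    intro f hf
    obtain ⟨i, rfl⟩ := (List.mem_ofFn' _ _).1 hf
    refine (abs_evalDatabase_sub_le hDD' (hq i)).trans_eq ?_
    rw [hη]; field_simp
  have hdom : IsDominated (Real.exp (κ * (c.maxBad + 1 - (0 : ℕ)))) m
      (mechanism c q D) (mechanism c q D') := by
    refine .bind
      ((isRegular_of_pos c hε hσ D _ _ _ ∅ 0 0 hu).1.comp (measurable_const_add _))
      ((isRegular_of_pos c hε hσ D' _ _ _ ∅ 0 0 hu).1.comp (measurable_const_add _)) fun y => ?_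
    exact isDominated_run hε hσ hη0 hκ hκ1 _ hqs 0 (by push_cast; linarith) _ _ _ _ _ hu
  refine (hdom S hS _ (Real.exp_pos ε)).trans ?_
  gcongr
  -- The exponent is at most `1 - m ε ≤ 1 - 2 ℓ ≤ -ℓ ≤ log δ`, as `ℓ ≥ 1`.
  rw [← Real.exp_nat_mul, ← Real.exp_sub, ← Real.le_log_iff_exp_le hδ]
  have h1 : ℓ = Real.log 4 - Real.log δ := Real.log_div (by norm_num) hδ.ne'
  have h2 : 0 ≤ Real.log 4 := Real.log_nonneg (by norm_num)
  have h3 : 2 * ℓ ≤ m * ε := by rwa [div_le_iff₀ hε] at hm1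
  push_cast
  linarith

end OnlineQueryRelease

theorem mainTheorem8 {X : Type*} [Fintype X] (n k : ℕ) (hn : 0 < n) (hk : 0 < k)
    (ε δ β step : ℝ) (hε : 0 < ε) (hε1 : ε ≤ 1) (hδ : 0 < δ) (hδ1 : δ ≤ 1)
    (hβ : 0 < β) (hβ1 : β ≤ 1)
    (q : Fin k → X → ℝ) (hq : ∀ i x, q i x ∈ Set.Icc (0 : ℝ) 1) :
    OnlineQueryRelease.IsDifferentiallyPrivate ε δ
      (fun D : Fin n → X =>
        OnlineQueryRelease.mechanism
          (OnlineQueryRelease.Config.online n (Fintype.card X) k ε δ β step) q D) := by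
  open OnlineQueryRelease in
  set c := Config.online n (Fintype.card X) k ε δ β step with hc
  have hceps : c.eps = ε := rfl
  have hX : ∀ D : Fin n → X, Nonempty X := fun D => ⟨D ⟨0, hn⟩⟩
  rcases le_or_gt 2 (Fintype.card X) with hN | hN
  · have hσ : 0 < c.noise := online_noise_pos hn hk hN hε hδ hδ1 hβ hβ1
    obtain ⟨hR, hbudget⟩ :=
      online_budget (step := step) hn hk hN hε hε1 hδ hδ1 hβ hβ1
    refine ⟨fun D => ?_, fun D D' h S hS => ?_⟩
    · have := hX D
      exact isProbabilityMeasure_mechanism hε q (isRegular_of_pos c hε hσ D _)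
    · have := hX D
      exact mechanism_le hn hε hε1 hδ hδ1 hσ hR hbudget hq h hS
  -- With at most one data point all databases coincide, so only the normalization of the law needs
  -- an argument.
  · have hsub : Subsingleton X := Fintype.card_le_one_iff_subsingleton.1 (by omega)
    refine ⟨fun D => ?_, fun D D' _ S _ => ?_⟩
    · have := hX D
      have hT : c.maxEpochs ≤ 0 := by
        have h1 : Fintype.card X = 1 := le_antisymm (by omega) Fintype.card_pos
        rw [hc, h1, online_maxEpochs_eq_zero]
      exact isProbabilityMeasure_mechanism hε q (isRegular_of_maxEpochs_nonpos c hT D _)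
    · rw [Subsingleton.elim D' D]
      refine le_add_right (le_mul_of_one_le_left' ?_)
      rw [ENNReal.one_le_ofReal]
      exact Real.one_le_exp hε.le
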